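/- **Setting.** A function $\sigma:\mathbb R\to\mathbb R$ is a *Tauber–Wiener function* if for all $a<b$, $\varepsilon>0$ and $f\in C([a,b])$ there is a linear combination $g(t)=\sum_{i=1}^N c_i\,\sigma(\lambda_i t+\theta_i)$ with real coefficients such that $|f(t)-g(t)|<\varepsilon$ for all $t\in[a,b]$. A *ReLU network* is a map $q(x)=A_L\,\mathrm{ReLU}(A_{L-1}\cdots\mathrm{ReLU}(A_1x+b_1)+\cdots+b_{L-1})+b_L$ with $L\ge 1$, matrices $A_\ell$, vectors $b_\ell$, and $\mathrm{ReLU}(a)=\max\{a,0\}$ applied coordinatewise. Let $\Omega_W$ and $\Omega_U$ be non-empty compact subsets of Banach spaces, $\Omega_V$ a compact subset of $\mathbb R^n$, $W\subseteq C(\Omega_W)$ and $U\subseteq C(\Omega_U)$ compact in the uniform norm (all functions real-valued), and $V=C(\Omega_V)$. Let $\nu$ and $\mu$ be Borel probability measures on $W$ and $U$, and let $\lambda$ be Lebesgue measure on $\Omega_V$. Let $\sigma$ be a Tauber–Wiener function that is continuous, or bounded and Borel measurable (or both). Given positive integers $m,p$ and points $z_1,\dots,z_p\in\Omega_W$, $x_1,\dots,x_m\in\Omega_U$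 (so that the networks see $\alpha$ and $u$ only through the discretizations $\boldsymbol\alpha=(\alpha(z_1),\dots,\alpha(z_p))$ and $\mathbf u=(u(x_1),\dots,u(x_m))$), consider the following two kinds of networks, with positive integer sizes $N,M,P,Q,J,H_1,\dots,H_Q$, vectors $\omega_k,\omega_{qk}\in\mathbb R^n$, and all other parameters real: * a *MONet with ReLU networks* $\gamma_{ki}:\mathbb R\to\mathbb R$ in the $\alpha$-branch, $$\mathcal N[\alpha][u](x)=\sum_{k=1}^N\sum_{i=1}^M \sigma(\omega_k\cdot x+\zeta_k)\;\sigma\Big(\sum_{l=1}^m\xi_{kil}u(x_l)+\theta_{ki}\Big)\;\gamma_{ki}\Big(\sum_{j=1}^P c_{kij}\,\sigma\Big(\sum_{h=1}^p\varphi_{kijh}\alpha(z_h)+\rho_{kij}\Big)\Big);$$ * an *MNO with shallow sub-networks*, $$\mathcal N[\alpha][u](x)=\sum_{q=1}^{Q}\Big(\sum_{j=1}^{J} c_{qj}\,\sigma\Big(\sum_{h=1}^p\varphi_{qjh}\alpha(z_h)+\rho_{qj}\Big)\Big)\sum_{k=1}^{H_q}\sigma\Big(\sum_{l=1}^m\xi_{qkl}u(x_l)+\theta_{qk}\Big)\,\sigma(\omega_{qk}\cdot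 x+\zeta_{qk}).$$ **Theorem (Universal approximation for multiple operators in $L^2$).** Suppose that for every $\alpha\in W$ the operator $G[\alpha]:U\to V$ (in general nonlinear) is continuous, that the map $\alpha\mapsto G[\alpha]$ is Borel measurable from $W$ to $C(U,V)$ with the topology of uniform convergence, and that $(\alpha,u,x)\mapsto G[\alpha][u](x)$ belongs to $L^2_{\nu\times\mu\times\lambda}(W\times U\times\Omega_V)$. Fix any dense sequences $(z_h)_{h\ge1}$ in $\Omega_W$ and $(x_l)_{l\ge1}$ in $\Omega_U$. Then for every $\varepsilon>0$ there exist a MONet $\mathcal N$ with bounded ReLU networks $\gamma_{ki}$ in the $\alpha$-branch, and also an MNO $\mathcal N$ with shallow sub-networks, each sampling $\alpha$ at the first $p$ points $z_1,\dots,z_p$ and $u$ at the first $m$ points $x_1,\dots,x_m$ of these sequences for some $p,m\ge1$, such that $\mathcal N\in L^2_{\nu\times\mu\times\lambda}(W\times U\times\Omega_V)$ and $$\big\|G[\alpha][u](x)-\mathcal N[\alpha][u](x)\big\|_{L^2_{\nu\times\mu\times\lambda}(W\times U\times\Omega_V)}<\varepsilon .$$ -/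

import Mathlib

open MeasureTheory
open scoped ENNReal Matrix

/-- Spaces of continuous maps carry the Borel σ-algebra of the compact-open topology, which for a
compact source and a metric target is the topology of uniform convergence. -/
instance ContinuousMap.instMeasurableSpaceBorel {X Y : Type*} [TopologicalSpace X]
    [TopologicalSpace Y] : MeasurableSpace C(X, Y) :=
  borel C(X, Y)

instance ContinuousMap.instBorelSpaceBorel {X Y : Type*} [TopologicalSpace X]
    [TopologicalSpace Y] : BorelSpace C(X, Y) :=
  ⟨rfl⟩

/-- Lebesgue measure on a subset of `ℝⁿ`, as a measure on the subtype. -/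
noncomputable def lebesgueOn {n : ℕ} (Ω : Set (EuclideanSpace ℝ (Fin n))) : Measure Ω :=
  (volume : Measure (EuclideanSpace ℝ (Fin n))).comap Subtype.val

/-- Tauber–Wiener functions: the linear combinations of the dilated and translated copies of `σ`
approximate every continuous function uniformly on every compact interval. -/
def IsTauberWiener (σ : ℝ → ℝ) : Prop :=
  ∀ a b : ℝ, a < b → ∀ ε : ℝ, 0 < ε → ∀ f : ℝ → ℝ, ContinuousOn f (Set.Icc a b) →
    ∃ (N : ℕ) (c lam θ : Fin N → ℝ), ∀ t ∈ Set.Icc a b,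
      |f t - ∑ i, c i * σ (lam i * t + θ i)| < ε

/-- Feedforward ReLU networks
`x ↦ W_L ReLU(W_{L-1} ⋯ ReLU(W_1 x + b_1) + ⋯ + b_{L-1}) + b_L` from `ℝ^d` to `ℝ^e`,
with `L ≥ 1` affine layers and ReLU applied coordinatewise between consecutive layers. -/
inductive IsReLUNetwork {d : ℕ} : (e : ℕ) → ((Fin d → ℝ) → (Fin e → ℝ)) → Prop
  | affine {e : ℕ} (A : Matrix (Fin e) (Fin d) ℝ) (b : Fin e → ℝ) :
      IsReLUNetwork e (fun x => A *ᵥ x + b)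
  | layer {e e' : ℕ} (q : (Fin d → ℝ) → (Fin e → ℝ)) (hq : IsReLUNetwork e q)
      (A : Matrix (Fin e') (Fin e) ℝ) (b : Fin e' → ℝ) :
      IsReLUNetwork e' (fun x => A *ᵥ (fun i => max (q x i) 0) + b)

/-- A ReLU network with one scalar input and one scalar output. -/
def IsScalarReLUNetwork (γ : ℝ → ℝ) : Prop :=
  ∃ q : (Fin 1 → ℝ) → (Fin 1 → ℝ), IsReLUNetwork 1 q ∧ ∀ t : ℝ, γ t = q (fun _ => t) 0

section Architectures

variable {A B : Type*} [TopologicalSpace A] [TopologicalSpace B]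

/-- The parameters of a MONet network for inputs `α ∈ C(ΩW)`, `u ∈ C(ΩU)`, `x ∈ ℝⁿ`. -/
structure MONet (ΩW : Set A) (ΩU : Set B) (n : ℕ) where
  (M N P m p : ℕ)
  M_pos : 0 < M
  N_pos : 0 < N
  P_pos : 0 < P
  m_pos : 0 < m
  p_pos : 0 < p
  /-- points at which `u` is sampled -/
  x : Fin m → ΩU
  /-- points at which `α` is sampled -/
  z : Fin p → ΩW
  ω : Fin N → EuclideanSpace ℝ (Fin n)
  ζ : Fin N → ℝ
  ξ : Fin N → Fin M → Fin m → ℝ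
  θ : Fin N → Fin M → ℝ
  c : Fin N → Fin M → Fin P → ℝ
  φ : Fin N → Fin M → Fin P → Fin p → ℝ
  ρ : Fin N → Fin M → Fin P → ℝ

namespace MONet

variable {ΩW : Set A} {ΩU : Set B} {n : ℕ}

/-- `τ_k(x) = σ(ω_k ⬝ x + ζ_k)`. -/
noncomputable def trunk (net : MONet ΩW ΩU n) (σ : ℝ → ℝ) (k : Fin net.N)
    (x : EuclideanSpace ℝ (Fin n)) : ℝ :=
  σ (inner ℝ (net.ω k) x + net.ζ k)

/-- `b_{ki}(u) = σ(∑_l ξ_{kil} u(x_l) + θ_{ki})`. -/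
noncomputable def branch (net : MONet ΩW ΩU n) (σ : ℝ → ℝ) (k : Fin net.N) (i : Fin net.M)
    (u : C(ΩU, ℝ)) : ℝ :=
  σ (∑ l, net.ξ k i l * u (net.x l) + net.θ k i)

/-- `∑_j c_{kij} σ(∑_h φ_{kijh} α(z_h) + ρ_{kij})`. -/
noncomputable def paramBranch (net : MONet ΩW ΩU n) (σ : ℝ → ℝ) (k : Fin net.N) (i : Fin net.M)
    (α : C(ΩW, ℝ)) : ℝ :=
  ∑ j, net.c k i j * σ (∑ h, net.φ k i j h * α (net.z h) + net.ρ k i j)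

/-- `∑_k τ_k(x) ∑_i b_{ki}(u) L_{ki}(α)`, where
`L_{ki}(α) = γ_{ki}(∑_j c_{kij} σ(∑_h φ_{kijh} α(z_h) + ρ_{kij}))`. -/
noncomputable def eval (net : MONet ΩW ΩU n) (σ : ℝ → ℝ) (γ : Fin net.N → Fin net.M → ℝ → ℝ)
    (α : C(ΩW, ℝ)) (u : C(ΩU, ℝ)) (x : EuclideanSpace ℝ (Fin n)) : ℝ :=
  ∑ k, net.trunk σ k x * ∑ i, net.branch σ k i u * γ k i (net.paramBranch σ k i α)

end MONet

/-- The parameters of an MNO network with shallow sub-networks. -/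
structure MNO (ΩW : Set A) (ΩU : Set B) (n : ℕ) where
  (P : ℕ)
  (H : Fin P → ℕ)
  (J m p : ℕ)
  P_pos : 0 < P
  H_pos : ∀ q, 0 < H q
  J_pos : 0 < J
  m_pos : 0 < m
  p_pos : 0 < p
  /-- points at which `u` is sampled -/
  x : Fin m → ΩU
  /-- points at which `α` is sampled -/
  z : Fin p → ΩW
  ω : (q : Fin P) → Fin (H q) → EuclideanSpace ℝ (Fin n)
  ζ : (q : Fin P) → Fin (H q) → ℝ
  ξ : (q : Fin P) → Fin (H q) → Fin m → ℝ
  θ : (q : Fin P) → Fin (H q) → ℝ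
  c : Fin P → Fin J → ℝ
  φ : Fin P → Fin J → Fin p → ℝ
  ρ : Fin P → Fin J → ℝ

namespace MNO

variable {ΩW : Set A} {ΩU : Set B} {n : ℕ}

/-- `τ_{qk}(x) = σ(ω_{qk} ⬝ x + ζ_{qk})`. -/
noncomputable def trunk (net : MNO ΩW ΩU n) (σ : ℝ → ℝ) (q : Fin net.P) (k : Fin (net.H q))
    (x : EuclideanSpace ℝ (Fin n)) : ℝ :=
  σ (inner ℝ (net.ω q k) x + net.ζ q k)

/-- `b_{qk}(u) = σ(∑_l ξ_{qkl} u(x_l) + θ_{qk})`. -/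
noncomputable def branch (net : MNO ΩW ΩU n) (σ : ℝ → ℝ) (q : Fin net.P) (k : Fin (net.H q))
    (u : C(ΩU, ℝ)) : ℝ :=
  σ (∑ l, net.ξ q k l * u (net.x l) + net.θ q k)

/-- `l_q(α) = ∑_j c_{qj} σ(∑_h φ_{qjh} α(z_h) + ρ_{qj})`. -/
noncomputable def paramBranch (net : MNO ΩW ΩU n) (σ : ℝ → ℝ) (q : Fin net.P)
    (α : C(ΩW, ℝ)) : ℝ :=
  ∑ j, net.c q j * σ (∑ h, net.φ q j h * α (net.z h) + net.ρ q j)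

/-- `∑_q l_q(α) ∑_k b_{qk}(u) τ_{qk}(x)`. -/
noncomputable def eval (net : MNO ΩW ΩU n) (σ : ℝ → ℝ)
    (α : C(ΩW, ℝ)) (u : C(ΩU, ℝ)) (x : EuclideanSpace ℝ (Fin n)) : ℝ :=
  ∑ q, net.paramBranch σ q α * ∑ k, net.branch σ q k u * net.trunk σ q k x

end MNO

end Architectures

/-! Both architectures contain all finite sums of products of three ridge functions, one in samples
of `α`, one in samples of `u`, one in `x`, so it suffices that such sums are dense in `L²` of the
compact metrizable space `W × U × ΩV`.

Products of exponentials of linear functionals of the three variables are closed under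
multiplication, so their span is an algebra. It separates points because a continuous function is
determined by its values on a dense sequence, and Stone–Weierstrass makes it uniformly dense. The
Tauber–Wiener property, applied to `exp` on an interval, turns each exponential factor into a sum of
ridge functions (`exists_mem_ridgeSpan_near`). Continuous functions are dense in `L²` of a finite
measure, where uniform closeness gives `L²` closeness (`exists_mem_ridgeSpan_eLpNorm_sub_lt`).

An MNO realizes such a sum directly. For a MONet, each `γ` is truncation to an interval containing
all values that its `α`-branch takes on the compact set `W`, so it is bounded and acts as the
identity there. -/

/-! ### Truncation by ReLU networks, and elementary estimates. -/

theorem isScalarReLUNetwork_clip (B : ℝ) :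
    IsScalarReLUNetwork (fun t => max (t + B) 0 - max (t - B) 0 - B) := by
  refine ⟨_, .layer (e := 2) _ (.affine (fun _ _ => 1) ![B, -B]) (fun _ => ![1, -1])
    (fun _ => -B), fun t => ?_⟩
  simp [Matrix.mulVec, dotProduct, Fin.sum_univ_two, sub_eq_add_neg]

theorem clip_eq_self {B t : ℝ} (h : |t| ≤ B) : max (t + B) 0 - max (t - B) 0 - B = t := by
  obtain ⟨h₁, h₂⟩ := abs_le.1 h
  rw [max_eq_left (by linarith), max_eq_right (by linarith)]
  ring

theorem abs_clip_le {B : ℝ} (hB : 0 ≤ B) (t : ℝ) :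
    |max (t + B) 0 - max (t - B) 0 - B| ≤ B := by
  rw [abs_le]
  rcases le_total (t + B) 0 with h₁ | h₁ <;> rcases le_total (t - B) 0 with h₂ | h₂ <;>
    simp only [max_eq_left, max_eq_right, h₁, h₂] <;> constructor <;> linarith

theorem exists_abs_le_of_continuous_or_bounded {σ : ℝ → ℝ}
    (hσ : Continuous σ ∨ (Measurable σ ∧ ∃ C : ℝ, ∀ t, |σ t| ≤ C)) (b : ℝ) :
    ∃ C : ℝ, ∀ t, |t| ≤ b → |σ t| ≤ C := by
  rcases hσ with hσ | ⟨-, C, hC⟩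
  · obtain ⟨C, hC⟩ := (isCompact_Icc (a := -b) (b := b)).exists_bound_of_continuousOn
      hσ.continuousOn
    exact ⟨C, fun t ht => hC t (abs_le.1 ht)⟩
  · exact ⟨C, fun t _ => hC t⟩

/-- Telescoping one factor at a time; `δ ≤ 1` bounds the perturbed factors by `K + 1`. -/
theorem abs_mul_mul_sub_le {a b c a' b' c' K δ : ℝ} (hδ : δ ≤ 1)
    (ha : |a| ≤ K) (hb : |b| ≤ K) (hc : |c| ≤ K)
    (haa : |a - a'| ≤ δ) (hbb : |b - b'| ≤ δ) (hcc : |c - c'| ≤ δ) :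
    |a * (b * c) - a' * (b' * c')| ≤ δ * (3 * (K + 1) ^ 2) := by
  have hK : 0 ≤ K := (abs_nonneg a).trans ha
  have hδ0 : 0 ≤ δ := (abs_nonneg _).trans haa
  have ha' : |a'| ≤ K + 1 := by
    have := abs_sub_abs_le_abs_sub a' a
    rw [abs_sub_comm] at this
    linarith
  have hb' : |b'| ≤ K + 1 := by
    have := abs_sub_abs_le_abs_sub b' b
    rw [abs_sub_comm] at this
    linarith
  have hb1 : |b| ≤ K + 1 := by linarith
  have hc1 : |c| ≤ K + 1 := by linarith
  calc |a * (b * c) - a' * (b' * c')|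
      = |(a - a') * (b * c) + (b - b') * (a' * c) + (c - c') * (a' * b')| := by
        congr 1; ring
    _ ≤ |a - a'| * (|b| * |c|) + |b - b'| * (|a'| * |c|) + |c - c'| * (|a'| * |b'|) := by
        simp only [← abs_mul]
        exact abs_add_three _ _ _
    _ ≤ δ * ((K + 1) * (K + 1)) + δ * ((K + 1) * (K + 1)) + δ * ((K + 1) * (K + 1)) := by
        gcongr
    _ = δ * (3 * (K + 1) ^ 2) := by ring

/-- The ridge functions of a Tauber–Wiener function approximate `exp ∘ f` for bounded `f`. -/
theorem IsTauberWiener.exists_approx_exp {σ : ℝ → ℝ} (hσ : IsTauberWiener σ) {X : Type*}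
    [TopologicalSpace X] [CompactSpace X] (f : C(X, ℝ)) {δ : ℝ} (hδ : 0 < δ) :
    ∃ (N : ℕ) (c lam θ : Fin N → ℝ), ∀ x,
      |Real.exp (f x) - ∑ i, c i * σ (lam i * f x + θ i)| ≤ δ := by
  obtain ⟨N, c, lam, θ, h⟩ := hσ (-(‖f‖ + 1)) (‖f‖ + 1) (by linarith [norm_nonneg f]) δ hδ
    Real.exp Real.continuous_exp.continuousOn
  refine ⟨N, c, lam, θ, fun x => (h _ ?_).le⟩
  have := abs_le.1 (f.norm_coe_le_norm x)
  exact ⟨by linarith, by linarith⟩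

/-! ### Uniform density of products of three ridge functions. -/

section Density

variable {X : Type*} [TopologicalSpace X] {L₁ L₂ L₃ : Type*}
  [AddCommGroup L₁] [Module ℝ L₁] [AddCommGroup L₂] [Module ℝ L₂] [AddCommGroup L₃] [Module ℝ L₃]

/-- The span of the products of three ridge functions, with activation `σ`, of linear functionals
from three given families. -/
def ridgeSpan (σ : ℝ → ℝ) (ℓ₁ : L₁ →ₗ[ℝ] C(X, ℝ)) (ℓ₂ : L₂ →ₗ[ℝ] C(X, ℝ))
    (ℓ₃ : L₃ →ₗ[ℝ] C(X, ℝ)) : Submodule ℝ (X → ℝ) :=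
  Submodule.span ℝ (Set.range fun (r : (L₁ × ℝ) × (L₂ × ℝ) × (L₃ × ℝ)) (x : X) =>
    σ (ℓ₁ r.1.1 x + r.1.2) * (σ (ℓ₂ r.2.1.1 x + r.2.1.2) * σ (ℓ₃ r.2.2.1 x + r.2.2.2)))

/-- Exponentials of the linear functionals from three given families. -/
noncomputable def expFunctional (ℓ₁ : L₁ →ₗ[ℝ] C(X, ℝ)) (ℓ₂ : L₂ →ₗ[ℝ] C(X, ℝ))
    (ℓ₃ : L₃ →ₗ[ℝ] C(X, ℝ)) : Multiplicative (L₁ × L₂ × L₃) →* C(X, ℝ) where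
  toFun l := ⟨fun x => Real.exp (ℓ₁ l.toAdd.1 x) *
    (Real.exp (ℓ₂ l.toAdd.2.1 x) * Real.exp (ℓ₃ l.toAdd.2.2 x)), by fun_prop⟩
  map_one' := by ext; simp
  map_mul' l l' := by
    ext x
    simp only [toAdd_mul, Prod.fst_add, Prod.snd_add, map_add, ContinuousMap.add_apply,
      Real.exp_add, ContinuousMap.coe_mk, ContinuousMap.mul_apply]
    ring

/-- Each exponential is approximated separately, as a function of one real variable; the dilations
are absorbed by rescaling the functionals, and the product of the three sums is expanded. -/
theorem exists_mem_ridgeSpan_near_expFunctional [CompactSpace X] {σ : ℝ → ℝ}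
    (hσ : IsTauberWiener σ)
    (ℓ₁ : L₁ →ₗ[ℝ] C(X, ℝ)) (ℓ₂ : L₂ →ₗ[ℝ] C(X, ℝ)) (ℓ₃ : L₃ →ₗ[ℝ] C(X, ℝ))
    (l : Multiplicative (L₁ × L₂ × L₃)) {ε : ℝ} (hε : 0 < ε) :
    ∃ g ∈ ridgeSpan σ ℓ₁ ℓ₂ ℓ₃, ∀ x, |expFunctional ℓ₁ ℓ₂ ℓ₃ l x - g x| ≤ ε := by
  obtain ⟨l₁, l₂, l₃⟩ := l
  obtain ⟨K, hK0, hK₁, hK₂, hK₃⟩ : ∃ K : ℝ, 0 ≤ K ∧ (∀ x, |Real.exp (ℓ₁ l₁ x)| ≤ K) ∧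
      (∀ x, |Real.exp (ℓ₂ l₂ x)| ≤ K) ∧ ∀ x, |Real.exp (ℓ₃ l₃ x)| ≤ K := by
    have key (f : C(X, ℝ)) (K : ℝ) (h : ‖f‖ ≤ K) (x : X) : |Real.exp (f x)| ≤ Real.exp K := by
      rw [Real.abs_exp]
      exact Real.exp_le_exp.2 (((le_abs_self _).trans (f.norm_coe_le_norm x)).trans h)
    refine ⟨Real.exp (‖ℓ₁ l₁‖ + (‖ℓ₂ l₂‖ + ‖ℓ₃ l₃‖)), (Real.exp_pos _).le, key _ _ ?_, key _ _ ?_,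
      key _ _ ?_⟩ <;> linarith [norm_nonneg (ℓ₁ l₁), norm_nonneg (ℓ₂ l₂), norm_nonneg (ℓ₃ l₃)]
  have hD : 0 < 3 * (K + 1) ^ 2 := by positivity
  have hδ : 0 < min 1 (ε / (3 * (K + 1) ^ 2)) := lt_min one_pos (div_pos hε hD)
  obtain ⟨N₁, c₁, lam₁, θ₁, h₁⟩ := hσ.exists_approx_exp (ℓ₁ l₁) hδ
  obtain ⟨N₂, c₂, lam₂, θ₂, h₂⟩ := hσ.exists_approx_exp (ℓ₂ l₂) hδ
  obtain ⟨N₃, c₃, lam₃, θ₃, h₃⟩ := hσ.exists_approx_exp (ℓ₃ l₃) hδ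
  refine ⟨∑ i, ∑ j, ∑ k, (c₁ i * c₂ j * c₃ k) • fun x =>
    σ (ℓ₁ (lam₁ i • l₁) x + θ₁ i) * (σ (ℓ₂ (lam₂ j • l₂) x + θ₂ j) *
      σ (ℓ₃ (lam₃ k • l₃) x + θ₃ k)), ?_, fun x => ?_⟩
  · refine Submodule.sum_mem _ fun i _ => Submodule.sum_mem _ fun j _ =>
      Submodule.sum_mem _ fun k _ => Submodule.smul_mem _ _ (Submodule.subset_span ?_)
    exact ⟨((lam₁ i • l₁, θ₁ i), (lam₂ j • l₂, θ₂ j), (lam₃ k • l₃, θ₃ k)), rfl⟩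
  · have := abs_mul_mul_sub_le (min_le_left _ _) (hK₁ x) (hK₂ x) (hK₃ x) (h₁ x) (h₂ x) (h₃ x)
    have hsum : (∑ i, ∑ j, ∑ k, (c₁ i * c₂ j * c₃ k) • fun x =>
        σ (ℓ₁ (lam₁ i • l₁) x + θ₁ i) * (σ (ℓ₂ (lam₂ j • l₂) x + θ₂ j) *
          σ (ℓ₃ (lam₃ k • l₃) x + θ₃ k))) x =
        (∑ i, c₁ i * σ (lam₁ i * ℓ₁ l₁ x + θ₁ i)) *
          ((∑ i, c₂ i * σ (lam₂ i * ℓ₂ l₂ x + θ₂ i)) *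
            ∑ i, c₃ i * σ (lam₃ i * ℓ₃ l₃ x + θ₃ i)) := by
      simp only [Finset.sum_apply, Pi.smul_apply, smul_eq_mul, map_smul,
        ContinuousMap.smul_apply]
      rw [Finset.sum_mul_sum, Finset.sum_mul_sum]
      refine Finset.sum_congr rfl fun i _ => Finset.sum_congr rfl fun j _ => ?_
      rw [Finset.mul_sum]
      exact Finset.sum_congr rfl fun k _ => by ring
    rw [hsum]
    refine this.trans ?_
    calc _ ≤ ε / (3 * (K + 1) ^ 2) * (3 * (K + 1) ^ 2) := by gcongr; exact min_le_right _ _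
      _ = ε := div_mul_cancel₀ _ hD.ne'

/-- If the three families of linear functionals jointly separate points, then the products of their
ridge functions span a uniformly dense set of functions. -/
theorem exists_mem_ridgeSpan_near [CompactSpace X] {σ : ℝ → ℝ} (hσ : IsTauberWiener σ)
    (ℓ₁ : L₁ →ₗ[ℝ] C(X, ℝ)) (ℓ₂ : L₂ →ₗ[ℝ] C(X, ℝ)) (ℓ₃ : L₃ →ₗ[ℝ] C(X, ℝ))
    (hsep : ∀ x y, (∀ l, ℓ₁ l x = ℓ₁ l y) → (∀ l, ℓ₂ l x = ℓ₂ l y) → (∀ l, ℓ₃ l x = ℓ₃ l y) → x = y)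
    (f : C(X, ℝ)) {ε : ℝ} (hε : 0 < ε) :
    ∃ g ∈ ridgeSpan σ ℓ₁ ℓ₂ ℓ₃, ∀ x, |f x - g x| ≤ ε := by
  -- The tolerance is quantified inside the induction, since sums and scalar multiples require
  -- smaller errors for their constituents.
  have hspan : ∀ h ∈ Submodule.span ℝ (Set.range (expFunctional ℓ₁ ℓ₂ ℓ₃)), ∀ δ : ℝ, 0 < δ →
      ∃ g ∈ ridgeSpan σ ℓ₁ ℓ₂ ℓ₃, ∀ x, |h x - g x| ≤ δ := by
    intro h hh
    induction hh using Submodule.span_induction with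
    | mem _ hh =>
      obtain ⟨l, rfl⟩ := hh
      exact fun δ hδ => exists_mem_ridgeSpan_near_expFunctional hσ ℓ₁ ℓ₂ ℓ₃ l hδ
    | zero => exact fun δ hδ => ⟨0, zero_mem _, fun x => by simpa using hδ.le⟩
    | add h₁ h₂ _ _ ih₁ ih₂ =>
      intro δ hδ
      obtain ⟨g₁, hg₁, hb₁⟩ := ih₁ (δ / 2) (half_pos hδ)
      obtain ⟨g₂, hg₂, hb₂⟩ := ih₂ (δ / 2) (half_pos hδ)
      refine ⟨g₁ + g₂, add_mem hg₁ hg₂, fun x => ?_⟩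
      calc _ = |(h₁ x - g₁ x) + (h₂ x - g₂ x)| := by
            congr 1; simp only [ContinuousMap.add_apply, Pi.add_apply]; ring
        _ ≤ _ := abs_add_le _ _
        _ ≤ δ := by linarith [hb₁ x, hb₂ x]
    | smul a h _ ih =>
      intro δ hδ
      have ha : 0 < |a| + 1 := by positivity
      obtain ⟨g, hg, hb⟩ := ih (δ / (|a| + 1)) (div_pos hδ ha)
      refine ⟨a • g, Submodule.smul_mem _ _ hg, fun x => ?_⟩
      calc _ = |a| * |h x - g x| := by
            rw [← abs_mul, mul_sub]; simp
        _ ≤ (|a| + 1) * (δ / (|a| + 1)) := by gcongr; exacts [by linarith, hb x]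
        _ = δ := mul_div_cancel₀ _ ha.ne'
  -- The range of a monoid homomorphism is already a submonoid, so adjoining it adds only linear
  -- combinations.
  have hadj : Subalgebra.toSubmodule (Algebra.adjoin ℝ (Set.range (expFunctional ℓ₁ ℓ₂ ℓ₃)))
      = Submodule.span ℝ (Set.range (expFunctional ℓ₁ ℓ₂ ℓ₃)) := by
    rw [Algebra.adjoin_eq_span, ← MonoidHom.coe_mrange, Submonoid.closure_eq]
  have hpts : (Algebra.adjoin ℝ (Set.range (expFunctional ℓ₁ ℓ₂ ℓ₃))).SeparatesPoints := by
    intro x y hxy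
    by_contra! hall
    have hall (l : L₁ × L₂ × L₃) : expFunctional ℓ₁ ℓ₂ ℓ₃ (.ofAdd l) x =
        expFunctional ℓ₁ ℓ₂ ℓ₃ (.ofAdd l) y :=
      hall _ ⟨_, Algebra.subset_adjoin ⟨_, rfl⟩, rfl⟩
    -- Setting two functionals to zero isolates the third exponential, and `exp` is injective.
    refine hxy (hsep x y (fun l => ?_) (fun l => ?_) (fun l => ?_))
    · simpa [expFunctional] using hall (l, 0, 0)
    · simpa [expFunctional] using hall (0, l, 0)
    · simpa [expFunctional] using hall (0, 0, l)
  obtain ⟨⟨h, hh⟩, hfh⟩ :=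
    ContinuousMap.exists_mem_subalgebra_near_continuousMap_of_separatesPoints _ hpts f (ε / 2)
      (half_pos hε)
  obtain ⟨g, hg, hb⟩ := hspan h (hadj ▸ hh) (ε / 2) (half_pos hε)
  refine ⟨g, hg, fun x => ?_⟩
  have h₁ : |h x - f x| ≤ ε / 2 := ((h - f).norm_coe_le_norm x).trans hfh.le
  rw [abs_sub_comm] at h₁
  linarith [abs_sub_le (f x) (h x) (g x), hb x]

theorem exists_eq_sum_of_mem_ridgeSpan {σ : ℝ → ℝ} {ℓ₁ : L₁ →ₗ[ℝ] C(X, ℝ)}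
    {ℓ₂ : L₂ →ₗ[ℝ] C(X, ℝ)} {ℓ₃ : L₃ →ₗ[ℝ] C(X, ℝ)} {g : X → ℝ}
    (hg : g ∈ ridgeSpan σ ℓ₁ ℓ₂ ℓ₃) :
    ∃ (R : ℕ) (c : Fin (R + 1) → ℝ) (l₁ : Fin (R + 1) → L₁) (θ₁ : Fin (R + 1) → ℝ)
      (l₂ : Fin (R + 1) → L₂) (θ₂ : Fin (R + 1) → ℝ)
      (l₃ : Fin (R + 1) → L₃) (θ₃ : Fin (R + 1) → ℝ), ∀ x,
      g x = ∑ r, c r * (σ (ℓ₁ (l₁ r) x + θ₁ r) *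
        (σ (ℓ₂ (l₂ r) x + θ₂ r) * σ (ℓ₃ (l₃ r) x + θ₃ r))) := by
  obtain ⟨R, c, v, rfl⟩ := (Submodule.mem_span_set' ..).1 hg
  choose r hr using fun i => (v i).2
  -- A term with coefficient zero is prepended so that the sum is never empty: network sizes must be
  -- positive.
  refine ⟨R, Fin.cons 0 c, Fin.cons 0 fun i => (r i).1.1, Fin.cons 0 fun i => (r i).1.2,
    Fin.cons 0 fun i => (r i).2.1.1, Fin.cons 0 fun i => (r i).2.1.2,
    Fin.cons 0 fun i => (r i).2.2.1, Fin.cons 0 fun i => (r i).2.2.2, fun x => ?_⟩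
  simp [Fin.sum_univ_succ, ← hr]

end Density

theorem isFiniteMeasure_lebesgueOn {n : ℕ} {Ω : Set (EuclideanSpace ℝ (Fin n))}
    (hΩ : IsCompact Ω) : IsFiniteMeasure (lebesgueOn Ω) := by
  refine ⟨?_⟩
  rw [lebesgueOn, (MeasurableEmbedding.subtype_coe hΩ.measurableSet).comap_apply]
  simpa using hΩ.measure_lt_top

/-! ### Point samples as linear functionals. -/

section Sampling

variable {Ω : Type*} [TopologicalSpace Ω]

/-- Finite linear combinations of point evaluations at the members of a sequence. -/
noncomputable def sampling (z : ℕ → Ω) (φ : ℕ →₀ ℝ) (α : C(Ω, ℝ)) : ℝ :=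
  Finsupp.linearCombination ℝ (fun h => α (z h)) φ

theorem continuous_sampling (z : ℕ → Ω) (φ : ℕ →₀ ℝ) : Continuous (sampling z φ) := by
  unfold sampling
  simp only [Finsupp.linearCombination_apply, Finsupp.sum]
  fun_prop

theorem sampling_eq_sum_fin (z : ℕ → Ω) {φ : ℕ →₀ ℝ} {p : ℕ} (hp : φ.support ⊆ Finset.range p)
    (α : C(Ω, ℝ)) : sampling z φ α = ∑ h : Fin p, φ h * α (z h) := by
  rw [sampling, Finsupp.linearCombination_apply, Finsupp.sum_of_support_subset _ hp _ (by simp),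
    Finset.sum_range]
  rfl

theorem eq_of_forall_sampling_eq {z : ℕ → Ω} (hz : DenseRange z) {α β : C(Ω, ℝ)}
    (h : ∀ φ, sampling z φ α = sampling z φ β) : α = β := by
  refine DFunLike.coe_injective (hz.equalizer α.continuous β.continuous (funext fun k => ?_))
  simpa [sampling] using h (.single k 1)

/-- `sampling` as a family of continuous functionals of a parameter. -/
noncomputable def samplingFunctional {X : Type*} [TopologicalSpace X] (z : ℕ → Ω)
    (a : C(X, C(Ω, ℝ))) : (ℕ →₀ ℝ) →ₗ[ℝ] C(X, ℝ) where
  toFun φ := ⟨fun x => sampling z φ (a x), (continuous_sampling z φ).comp a.continuous⟩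
  map_add' φ ψ := by ext; simp [sampling]
  map_smul' r φ := by ext; simp [sampling]

theorem exists_pos_forall_support_subset_range {ι : Type*} [Fintype ι] (φ : ι → ℕ →₀ ℝ) :
    ∃ p, 0 < p ∧ ∀ i, (φ i).support ⊆ Finset.range p := by
  refine ⟨(Finset.univ.sup fun i => (φ i).support.sup id) + 1, Nat.succ_pos _, fun i h hh => ?_⟩
  rw [Finset.mem_range, Nat.lt_succ_iff]
  exact (Finset.le_sup (f := id) hh).trans
    (Finset.le_sup (f := fun i => (φ i).support.sup id) (Finset.mem_univ i))

end Sampling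

/-- Inner products with a fixed vector as a family of continuous functionals of a parameter. -/
noncomputable def innerFunctional {X E : Type*} [TopologicalSpace X] [NormedAddCommGroup E]
    [InnerProductSpace ℝ E] (v : C(X, E)) : E →ₗ[ℝ] C(X, ℝ) where
  toFun w := ⟨fun x => inner ℝ w (v x), by fun_prop⟩
  map_add' w w' := by ext; simp [inner_add_left]
  map_smul' r w := by ext; simp [inner_smul_left]

/-! ### From uniform density to density in `L²`. -/

section L2

variable {X : Type*} [TopologicalSpace X] {L₁ L₂ L₃ : Type*}
  [AddCommGroup L₁] [Module ℝ L₁] [AddCommGroup L₂] [Module ℝ L₂] [AddCommGroup L₃] [Module ℝ L₃]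

theorem measurable_of_mem_ridgeSpan [MeasurableSpace X] [BorelSpace X] {σ : ℝ → ℝ}
    (hσ : Measurable σ) {ℓ₁ : L₁ →ₗ[ℝ] C(X, ℝ)} {ℓ₂ : L₂ →ₗ[ℝ] C(X, ℝ)}
    {ℓ₃ : L₃ →ₗ[ℝ] C(X, ℝ)} {g : X → ℝ} (hg : g ∈ ridgeSpan σ ℓ₁ ℓ₂ ℓ₃) : Measurable g := by
  induction hg using Submodule.span_induction with
  | mem _ h =>
    obtain ⟨⟨⟨l₁, θ₁⟩, ⟨l₂, θ₂⟩, l₃, θ₃⟩, rfl⟩ := h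
    have key (f : C(X, ℝ)) (θ : ℝ) : Measurable fun x => σ (f x + θ) :=
      hσ.comp (f.measurable.add_const θ)
    exact (key _ _).mul ((key _ _).mul (key _ _))
  | zero => exact measurable_zero
  | add _ _ _ _ h₁ h₂ => exact h₁.add h₂
  | smul a _ _ h => exact h.const_smul a

/-- If the three families of linear functionals jointly separate points, then the products of their
ridge functions span a dense subspace of `L²` of a finite measure. -/
theorem exists_mem_ridgeSpan_eLpNorm_sub_lt [CompactSpace X] [TopologicalSpace.PseudoMetrizableSpace X]
    [MeasurableSpace X] [BorelSpace X] (P : Measure X) [IsFiniteMeasure P] {σ : ℝ → ℝ}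
    (hσ : IsTauberWiener σ) (hσm : Measurable σ)
    (ℓ₁ : L₁ →ₗ[ℝ] C(X, ℝ)) (ℓ₂ : L₂ →ₗ[ℝ] C(X, ℝ)) (ℓ₃ : L₃ →ₗ[ℝ] C(X, ℝ))
    (hsep : ∀ x y, (∀ l, ℓ₁ l x = ℓ₁ l y) → (∀ l, ℓ₂ l x = ℓ₂ l y) → (∀ l, ℓ₃ l x = ℓ₃ l y) → x = y)
    {f : X → ℝ} (hf : MemLp f 2 P) {ε : ℝ} (hε : 0 < ε) :
    ∃ g ∈ ridgeSpan σ ℓ₁ ℓ₂ ℓ₃, MemLp g 2 P ∧ eLpNorm (f - g) 2 P < ENNReal.ofReal ε := by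
  let _ := TopologicalSpace.pseudoMetrizableSpacePseudoMetric X
  obtain ⟨F, hF, hFL⟩ := hf.exists_boundedContinuous_eLpNorm_sub_le (by simp)
    (ENNReal.ofReal_pos.2 (by positivity : 0 < ε / 3)).ne'
  -- `m = P(X)^(1/2)` compares the `L²` norm with the uniform norm; dividing by `m + 1` below also
  -- covers `P = 0`.
  set m : ℝ := (P Set.univ ^ (2 : ℝ≥0∞).toReal⁻¹).toReal with hm
  have hm0 : 0 ≤ m := ENNReal.toReal_nonneg
  obtain ⟨g, hg, hFg⟩ := exists_mem_ridgeSpan_near hσ ℓ₁ ℓ₂ ℓ₃ hsep F.toContinuousMap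
    (show 0 < ε / 3 / (m + 1) by positivity)
  have hgm := measurable_of_mem_ridgeSpan hσm hg
  have hFgL : MemLp (fun x => F x - g x) 2 P :=
    .of_bound (F.continuous.measurable.sub hgm).aestronglyMeasurable _ (.of_forall hFg)
  -- No bound on `σ` is needed: `g = F - (F - g)`, and `F - g` is bounded and measurable.
  have hgL : MemLp g 2 P := by
    convert hFL.sub hFgL using 1
    ext x
    simp
  refine ⟨g, hg, hgL, ?_⟩
  have hle : eLpNorm (fun x => F x - g x) 2 P ≤ ENNReal.ofReal (ε / 3) := by
    refine (eLpNorm_le_of_ae_bound (.of_forall hFg)).trans ?_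
    rw [← ENNReal.ofReal_toReal (ENNReal.rpow_ne_top_of_nonneg (by simp) (measure_ne_top P _)),
      ← hm, ← ENNReal.ofReal_mul hm0]
    apply ENNReal.ofReal_le_ofReal
    calc m * (ε / 3 / (m + 1)) ≤ (m + 1) * (ε / 3 / (m + 1)) := by gcongr; linarith
      _ = ε / 3 := by field_simp
  calc eLpNorm (f - g) 2 P = eLpNorm ((f - ⇑F) + fun x => F x - g x) 2 P := by
        congr 1; ext x; simp
    _ ≤ eLpNorm (f - ⇑F) 2 P + eLpNorm (fun x => F x - g x) 2 P :=
        eLpNorm_add_le (hf.sub hFL).aestronglyMeasurable hFgL.aestronglyMeasurable (by norm_num)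
    _ ≤ ENNReal.ofReal (ε / 3) + ENNReal.ofReal (ε / 3) := add_le_add hF hle
    _ = ENNReal.ofReal (ε / 3 + ε / 3) := (ENNReal.ofReal_add (by positivity) (by positivity)).symm
    _ < ENNReal.ofReal ε := (ENNReal.ofReal_lt_ofReal_iff hε).2 (by linarith)

end L2

/-! ### Application to the product space and assembly of the networks. -/

section Approximation

variable {A B : Type*} [MetricSpace A] [MetricSpace B]

/-- Sums of products of three `σ`-ridge functions, of samples of `α`, of samples of `u`, and of `x`,
are dense in `L²`. -/
theorem exists_sum_ridge_eLpNorm_sub_lt {σ : ℝ → ℝ} (hσ : IsTauberWiener σ) (hσm : Measurable σ)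
    {ΩW : Set A} (hΩW : IsCompact ΩW) {W : Set C(ΩW, ℝ)} (hW : IsCompact W)
    {ΩU : Set B} (hΩU : IsCompact ΩU) {U : Set C(ΩU, ℝ)} (hU : IsCompact U)
    {n : ℕ} {ΩV : Set (EuclideanSpace ℝ (Fin n))} (hΩV : IsCompact ΩV)
    (ν : Measure W) [IsFiniteMeasure ν] (μ : Measure U) [IsFiniteMeasure μ]
    {f : W × U × ΩV → ℝ} (hf : MemLp f 2 (ν.prod (μ.prod (lebesgueOn ΩV))))
    {z : ℕ → ΩW} (hz : DenseRange z) {x : ℕ → ΩU} (hx : DenseRange x) {ε : ℝ} (hε : 0 < ε) :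
    ∃ (R p m : ℕ) (c ρ θ ζ : Fin (R + 1) → ℝ) (φ : Fin (R + 1) → Fin p → ℝ)
      (ξ : Fin (R + 1) → Fin m → ℝ) (ω : Fin (R + 1) → EuclideanSpace ℝ (Fin n)) (g : _ → ℝ),
      0 < p ∧ 0 < m ∧ (∀ q : W × U × ΩV, g q = ∑ r,
        c r * (σ (∑ h, φ r h * q.1.1 (z h) + ρ r) * (σ (∑ l, ξ r l * q.2.1.1 (x l) + θ r) *
          σ (inner ℝ (ω r) q.2.2.1 + ζ r)))) ∧
      MemLp g 2 (ν.prod (μ.prod (lebesgueOn ΩV))) ∧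
      eLpNorm (fun q => f q - g q) 2 (ν.prod (μ.prod (lebesgueOn ΩV))) < ENNReal.ofReal ε := by
  have := isCompact_iff_compactSpace.1 hΩW
  have := isCompact_iff_compactSpace.1 hΩU
  have := isCompact_iff_compactSpace.1 hΩV
  have := isCompact_iff_compactSpace.1 hW
  have := isCompact_iff_compactSpace.1 hU
  have := isFiniteMeasure_lebesgueOn hΩV
  let a : C(W × U × ΩV, C(ΩW, ℝ)) := ⟨fun q => q.1.1, by fun_prop⟩
  let b : C(W × U × ΩV, C(ΩU, ℝ)) := ⟨fun q => q.2.1.1, by fun_prop⟩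
  let v : C(W × U × ΩV, EuclideanSpace ℝ (Fin n)) := ⟨fun q => q.2.2.1, by fun_prop⟩
  obtain ⟨g, hg, hgL, hfg⟩ := exists_mem_ridgeSpan_eLpNorm_sub_lt
    (ν.prod (μ.prod (lebesgueOn ΩV))) hσ hσm (samplingFunctional z a) (samplingFunctional x b)
    (innerFunctional v) (fun q q' h₁ h₂ h₃ => Prod.ext (Subtype.ext (eq_of_forall_sampling_eq hz h₁))
      (Prod.ext (Subtype.ext (eq_of_forall_sampling_eq hx h₂))
        (Subtype.ext (ext_inner_left ℝ h₃)))) hf hε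
  obtain ⟨R, c, φ, ρ, ξ, θ, ω, ζ, hsum⟩ := exists_eq_sum_of_mem_ridgeSpan hg
  obtain ⟨p, hp, hφ⟩ := exists_pos_forall_support_subset_range φ
  obtain ⟨m, hm, hξ⟩ := exists_pos_forall_support_subset_range ξ
  refine ⟨R, p, m, c, ρ, θ, ζ, fun r h => φ r h, fun r l => ξ r l, ω, g, hp, hm, fun q => ?_, hgL,
    hfg⟩
  rw [hsum]
  refine Finset.sum_congr rfl fun r _ => ?_
  rw [← sampling_eq_sum_fin z (hφ r), ← sampling_eq_sum_fin x (hξ r)]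
  rfl

end Approximation

theorem theorem3p2
    {A B : Type*}
    [NormedAddCommGroup A] [NormedSpace ℝ A] [CompleteSpace A]
    [NormedAddCommGroup B] [NormedSpace ℝ B] [CompleteSpace B]
    -- the activation function
    (σ : ℝ → ℝ) (hσ : IsTauberWiener σ)
    (hσ' : Continuous σ ∨ (Measurable σ ∧ ∃ C : ℝ, ∀ t, |σ t| ≤ C))
    -- the spaces
    (ΩW : Set A) (hΩW : IsCompact ΩW) (W : Set C(ΩW, ℝ)) (hW : IsCompact W)
    (ΩU : Set B) (hΩU : IsCompact ΩU) (U : Set C(ΩU, ℝ)) (hU : IsCompact U)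
    (n : ℕ) (ΩV : Set (EuclideanSpace ℝ (Fin n))) (hΩV : IsCompact ΩV)
    -- the measures
    (ν : Measure W) [IsProbabilityMeasure ν] (μ : Measure U) [IsProbabilityMeasure μ]
    -- the multiple operator map: every `G α` is a continuous map from `U` to `C(ΩV)`
    (G : W → C(U, C(ΩV, ℝ))) (hG : Measurable G)
    (hGL2 : MemLp (fun q : W × U × ΩV => G q.1 q.2.1 q.2.2) 2 (ν.prod (μ.prod (lebesgueOn ΩV))))
    -- the sampling points: any sequences that are dense in `ΩW` and `ΩU`
    (z : ℕ → ΩW) (hz : DenseRange z) (x : ℕ → ΩU) (hx : DenseRange x)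
    (ε : ℝ) (hε : 0 < ε) :
    (∃ (net : MONet ΩW ΩU n) (γ : Fin net.N → Fin net.M → ℝ → ℝ),
      (∀ h, net.z h = z h) ∧ (∀ l, net.x l = x l) ∧
      (∀ k i, IsScalarReLUNetwork (γ k i) ∧ ∃ R : ℝ, ∀ t, |γ k i t| ≤ R) ∧
      MemLp (fun q : W × U × ΩV => net.eval σ γ q.1 q.2.1 q.2.2) 2
        (ν.prod (μ.prod (lebesgueOn ΩV))) ∧
      eLpNorm (fun q : W × U × ΩV => G q.1 q.2.1 q.2.2 - net.eval σ γ q.1 q.2.1 q.2.2) 2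
        (ν.prod (μ.prod (lebesgueOn ΩV))) < ENNReal.ofReal ε) ∧
    (∃ net : MNO ΩW ΩU n,
      (∀ h, net.z h = z h) ∧ (∀ l, net.x l = x l) ∧
      MemLp (fun q : W × U × ΩV => net.eval σ q.1 q.2.1 q.2.2) 2
        (ν.prod (μ.prod (lebesgueOn ΩV))) ∧
      eLpNorm (fun q : W × U × ΩV => G q.1 q.2.1 q.2.2 - net.eval σ q.1 q.2.1 q.2.2) 2
        (ν.prod (μ.prod (lebesgueOn ΩV))) < ENNReal.ofReal ε) := by
  have hσm : Measurable σ := hσ'.elim Continuous.measurable And.left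
  obtain ⟨R, p, m, c, ρ, θ, ζ, φ, ξ, ω, g, hp, hm, hg, hgL, hGg⟩ :=
    exists_sum_ridge_eLpNorm_sub_lt hσ hσm hΩW hW hΩU hU hΩV ν μ hGL2 hz hx hε
  constructor
  -- Truncation levels: the arguments of `σ` stay bounded on the compact set `W`, and `σ` is bounded
  -- on bounded sets.
  · have hbd (r : Fin (R + 1)) : ∃ K : ℝ, 0 ≤ K ∧
        ∀ α ∈ W, |c r * σ (∑ h, φ r h * α (z h) + ρ r)| ≤ K := by
      obtain ⟨b, hb⟩ := hW.exists_bound_of_continuousOn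
        (f := fun α : C(ΩW, ℝ) => ∑ h, φ r h * α (z h) + ρ r)
        (Continuous.continuousOn (by fun_prop))
      obtain ⟨C, hC⟩ := exists_abs_le_of_continuous_or_bounded hσ' b
      refine ⟨|c r| * |C|, by positivity, fun α hα => ?_⟩
      rw [abs_mul]
      refine mul_le_mul_of_nonneg_left ?_ (abs_nonneg _)
      exact (hC _ (hb α hα)).trans (le_abs_self C)
    choose K hK0 hK using hbd
    -- One trunk unit per product. A MONet has no outer coefficients, so `c r` enters the
    -- `α`-branch, inside `γ`.
    let net : MONet ΩW ΩU n :=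
      { M := 1, N := R + 1, P := 1, m := m, p := p, M_pos := one_pos, N_pos := R.succ_pos
        P_pos := one_pos, m_pos := hm, p_pos := hp, x := fun l => x l, z := fun h => z h
        ω := ω, ζ := ζ, ξ := fun r _ => ξ r, θ := fun r _ => θ r, c := fun r _ _ => c r
        φ := fun r _ _ => φ r, ρ := fun r _ _ => ρ r }
    let γ : Fin net.N → Fin net.M → ℝ → ℝ :=
      fun r _ t => max (t + K r) 0 - max (t - K r) 0 - K r
    have heval : (fun q : W × U × ΩV => net.eval σ γ q.1 q.2.1 q.2.2) = g := by
      ext q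
      rw [hg]
      refine Finset.sum_congr rfl fun r _ => ?_
      have hclip := clip_eq_self (hK r q.1.1 q.1.2)
      simp only [MONet.trunk, MONet.branch, MONet.paramBranch, net, γ, Finset.univ_unique,
        Finset.sum_singleton, hclip]
      ring
    refine ⟨net, γ, fun _ => rfl, fun _ => rfl,
      fun r _ => ⟨isScalarReLUNetwork_clip _, K r, abs_clip_le (hK0 r)⟩, heval ▸ hgL, ?_⟩
    simpa only [← heval] using hGg
  · let net : MNO ΩW ΩU n :=
      { P := R + 1, H := fun _ => 1, J := 1, m := m, p := p, P_pos := R.succ_pos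
        H_pos := fun _ => one_pos, J_pos := one_pos, m_pos := hm, p_pos := hp
        x := fun l => x l, z := fun h => z h
        ω := fun r _ => ω r, ζ := fun r _ => ζ r, ξ := fun r _ => ξ r, θ := fun r _ => θ r
        c := fun r _ => c r, φ := fun r _ => φ r, ρ := fun r _ => ρ r }
    have heval : (fun q : W × U × ΩV => net.eval σ q.1 q.2.1 q.2.2) = g := by
      ext q
      rw [hg]
      refine Finset.sum_congr rfl fun r _ => ?_
      simp only [MNO.trunk, MNO.branch, MNO.paramBranch, net, Finset.univ_unique,
        Finset.sum_singleton]
      ring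
    refine ⟨net, fun _ => rfl, fun _ => rfl, heval ▸ hgL, ?_⟩
    simpa only [← heval] using hGg
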